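/- Let $G=(V,E)$ be a finite simple graph with vertex set $V=\{1,\dots,n\}$. For coefficients $a=(a_{ij})_{ij\in E}\in\mathbb{R}^{E}$ let $b(x)=\sum_{ij\in E}a_{ij}x_ix_j$, let $$B=\{(x,z)\in[0,1]^n\times\mathbb{R} : z=b(x)\}$$ be the graph of $b$, and let the McCormick relaxation $Q$ of $B$ be the set of all $(x,z)\in[0,1]^n\times\mathbb{R}$ for which there is $y\in[0,1]^{E}$ with $z=\sum_{ij\in E}a_{ij}y_{ij}$ and $y_{ij}\le x_i$, $y_{ij}\le x_j$, $y_{ij}\ge x_i+x_j-1$ for all $ij\in E$. An edge $ij$ is called positive if $a_{ij}>0$ and negative if $a_{ij}<0$. (1) If $a_{ij}\neq 0$ for all $ij\in E$, then $Q=\operatorname{conv}(B)$ if and only if every cycle of $G$ contains an even number of positive edges and an even number of negative edges. (2) Consequently, if $a_{ij}\ne 0$ for all $ij\in E$ and $Q=\operatorname{conv}(B)$, then $G$ is bipartite. (3) If $G$ is a forest, then $Q=\operatorname{conv}(B)$ for every choice of the coefficients $a_{ij}\in\mathbb{R}$. If $G$ is not a forest, then there are nonzero coefficients $a_{ij}$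 such that $Q\ne\operatorname{conv}(B)$. -/

import Mathlib

namespace Bilin

/-- The product `x i * x j` attached to the unordered pair `s(i, j)`. -/
def pairProd {n : ℕ} (x : Fin n → ℝ) (e : Sym2 (Fin n)) : ℝ :=
  Sym2.lift ⟨fun i j => x i * x j, fun _ _ => mul_comm _ _⟩ e

/-- The bilinear function `b(x) = ∑_{ij ∈ E} a_{ij} x_i x_j`, with one coefficient per edge of `G`. -/
def bilin {n : ℕ} (G : SimpleGraph (Fin n)) [DecidableRel G.Adj] (a : G.edgeSet → ℝ)
    (x : Fin n → ℝ) : ℝ :=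
  ∑ e : G.edgeSet, a e * pairProd x e

/-- The graph of `b` over the unit cube `[0,1]^n`. -/
def graphSet {n : ℕ} (G : SimpleGraph (Fin n)) [DecidableRel G.Adj] (a : G.edgeSet → ℝ) :
    Set ((Fin n → ℝ) × ℝ) :=
  {p | p.1 ∈ Set.Icc (0 : Fin n → ℝ) 1 ∧ p.2 = bilin G a p.1}

/-- The McCormick polytope `P(G)` in the variables `x` (one per vertex) and `y` (one per edge). -/
def polytopeP {n : ℕ} (G : SimpleGraph (Fin n)) : Set ((Fin n → ℝ) × (G.edgeSet → ℝ)) :=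
  {p | p.1 ∈ Set.Icc (0 : Fin n → ℝ) 1 ∧ p.2 ∈ Set.Icc (0 : G.edgeSet → ℝ) 1 ∧
    ∀ (i j : Fin n) (h : G.Adj i j),
      p.2 ⟨s(i, j), h⟩ ≤ p.1 i ∧ p.2 ⟨s(i, j), h⟩ ≤ p.1 j ∧
        p.1 i + p.1 j - 1 ≤ p.2 ⟨s(i, j), h⟩}

/-- The McCormick relaxation `Q(b)`. -/
def relaxQ {n : ℕ} (G : SimpleGraph (Fin n)) [DecidableRel G.Adj] (a : G.edgeSet → ℝ) :
    Set ((Fin n → ℝ) × ℝ) :=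
  {p | ∃ y : G.edgeSet → ℝ, (p.1, y) ∈ polytopeP G ∧ p.2 = ∑ e : G.edgeSet, a e * y e}

/-- The number of positive edges on a walk (each edge counted once). -/
noncomputable def numPos {n : ℕ} {G : SimpleGraph (Fin n)} (a : G.edgeSet → ℝ) {u v : Fin n}
    (w : G.Walk u v) : ℕ :=
  {e : G.edgeSet | (e : Sym2 (Fin n)) ∈ w.edges ∧ 0 < a e}.ncard

/-- The number of negative edges on a walk (each edge counted once). -/
noncomputable def numNeg {n : ℕ} {G : SimpleGraph (Fin n)} (a : G.edgeSet → ℝ) {u v : Fin n}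
    (w : G.Walk u v) : ℕ :=
  {e : G.edgeSet | (e : Sym2 (Fin n)) ∈ w.edges ∧ a e < 0}.ncard

end Bilin

/-!
Round all coordinates of a point `x` of the cube with one uniform threshold in `(0, 1]`, reversing
the threshold outside a vertex set `U`. The resulting random `0/1` vector has expectation `x`, and
the expected product along an edge is the McCormick lower bound if the edge leaves `U` and the upper
bound otherwise. So if the positive edges are exactly the edges with nonzero coefficient that leave
`U`, the lower boundary of `Q` lies in `conv B`; negating `a` gives the upper boundary.

Conversely, averaging the two McCormick inequalities that bound the term of an edge from below gives
an affine minorant of `b`, and `Q` attains it at the centre of the cube. If `Q = conv B`, the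
minorant touches `b` at a point of the cube, and among the edges with nonzero coefficient exactly
the positive ones leave the set `U` of coordinates equal to `1` there.

Finally, an edge set is a cut if and only if it meets every cycle evenly.
-/

namespace Bilin

open MeasureTheory Set SimpleGraph
open scoped symmDiff

section Cuts

variable {V : Type*} {G H : SimpleGraph V} {S T : Set (Sym2 V)} {u v w : V}

/-- The edges of `G` that belong to `S` form a cut of `G`: they are exactly the edges with one end
in some vertex set `U` and the other end outside. Allowing pairs in `S` that are not edges of `G`
lets the same `S` be used for `G` and for its subgraphs. -/
def IsCut (G : SimpleGraph V) (S : Set (Sym2 V)) : Prop :=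
  ∃ U : Set V, ∀ i j, G.Adj i j → (s(i, j) ∈ S ↔ (i ∈ U ↔ j ∉ U))

open Classical in
/-- The number of steps of a walk along pairs in `S`, counted with multiplicity. -/
noncomputable def crossings (S : Set (Sym2 V)) (p : G.Walk u v) : ℕ :=
  p.edges.countP (· ∈ S)

theorem crossings_nil : crossings S (.nil : G.Walk u u) = 0 := rfl

theorem crossings_append (p : G.Walk u v) (q : G.Walk v w) :
    crossings S (p.append q) = crossings S p + crossings S q := by
  simp [crossings]

theorem crossings_reverse (p : G.Walk u v) : crossings S p.reverse = crossings S p := by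
  simp [crossings]

theorem even_crossings_cons (h : G.Adj u v) (p : G.Walk v w) :
    Even (crossings S (.cons h p)) ↔ (s(u, v) ∈ S ↔ ¬ Even (crossings S p)) := by
  by_cases hS : s(u, v) ∈ S <;> simp [crossings, hS, Nat.even_add_one]

theorem ncard_edges_inter_eq_crossings {p : G.Walk u v} (hp : p.IsTrail) :
    ({e | e ∈ p.edges} ∩ S).ncard = crossings S p := by
  classical
  have hset : {e | e ∈ p.edges} ∩ S = (p.edges.filter (· ∈ S)).toFinset := by
    ext e
    simp
  rw [hset, ncard_coe_finset, List.toFinset_card_of_nodup (hp.edges_nodup.filter _), crossings,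
    List.countP_eq_length_filter]

theorem even_crossings_iff_of_cut {U : Set V}
    (hU : ∀ i j, G.Adj i j → (s(i, j) ∈ S ↔ (i ∈ U ↔ j ∉ U))) (p : G.Walk u v) :
    Even (crossings S p) ↔ (u ∈ U ↔ v ∈ U) := by
  induction p with
  | nil => simp [crossings_nil]
  | cons h p ih =>
    rw [even_crossings_cons, ih, hU _ _ h]
    tauto

theorem even_crossings_bypass [DecidableEq V]
    (hS : ∀ (v : V) (c : G.Walk v v), c.IsCycle → Even (crossings S c)) (p : G.Walk u v) :
    Even (crossings S p.bypass) ↔ Even (crossings S p) := by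
  induction p with
  | nil => rfl
  | @cons u w v h p ih =>
    rw [even_crossings_cons, ← ih, Walk.bypass]
    split_ifs with hu
    · set q := p.bypass.takeUntil u hu
      have hq : q.IsPath := p.bypass_isPath.takeUntil hu
      have hsplit : crossings S p.bypass =
          crossings S q + crossings S (p.bypass.dropUntil u hu) := by
        rw [← crossings_append, Walk.take_spec]
      -- The closed walk cut off by the bypass is a cycle unless it runs back and forth on one edge.
      have hloop : Even (crossings S (Walk.cons h q)) := by
        by_cases he : s(u, w) ∈ q.edges
        · rw [even_crossings_cons, hq.eq_adj_toWalk_of_mem_edges (Sym2.eq_swap ▸ he)]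
          simp [Adj.toWalk, even_crossings_cons, crossings_nil, Sym2.eq_swap]
        · exact hS _ _ ((Walk.cons_isCycle_iff _ h).2 ⟨hq, he⟩)
      rw [even_crossings_cons] at hloop
      rw [hsplit, Nat.even_add]
      tauto
    · rw [even_crossings_cons]

theorem even_crossings_of_closed
    (hS : ∀ (v : V) (c : G.Walk v v), c.IsCycle → Even (crossings S c)) (p : G.Walk u u) :
    Even (crossings S p) := by
  classical
  rw [← even_crossings_bypass hS, Walk.eq_nil_iff_nil.2 (Walk.isPath_iff_nil.1 p.bypass_isPath)]
  exact Even.zero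

theorem isCut_of_even_crossings_closed (hS : ∀ (v : V) (p : G.Walk v v), Even (crossings S p)) :
    IsCut G S := by
  let root (v : V) : V := (G.connectedComponentMk v).out
  have hroot (v : V) : G.Reachable (root v) v := ConnectedComponent.exact (Quot.out_eq _)
  refine ⟨{v | Even (crossings S (hroot v).some)}, fun i j h => ?_⟩
  have hij : root i = root j := congrArg Quot.out (ConnectedComponent.sound h.reachable)
  have hclosed (r s : V) (p : G.Walk r i) (q : G.Walk s j) (hrs : r = s) :
      s(i, j) ∈ S ↔ (Even (crossings S p) ↔ ¬ Even (crossings S q)) := by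
    subst hrs
    have hp := hS r (p.append (.cons h q.reverse))
    rw [crossings_append, Nat.even_add, even_crossings_cons, crossings_reverse] at hp
    tauto
  exact hclosed _ _ _ _ hij

theorem isCut_iff_forall_isCycle_even_crossings :
    IsCut G S ↔ ∀ (v : V) (c : G.Walk v v), c.IsCycle → Even (crossings S c) :=
  ⟨fun ⟨_, hU⟩ _ c _ => (even_crossings_iff_of_cut hU c).2 Iff.rfl,
    fun hS => isCut_of_even_crossings_closed fun _ => even_crossings_of_closed hS⟩

theorem isCut_iff_forall_isCycle_of_le (hHG : H ≤ G) :
    IsCut H S ↔ ∀ (v : V) (c : G.Walk v v), c.IsCycle → (∀ e ∈ c.edges, e ∈ H.edgeSet) →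
      Even (crossings S c) := by
  rw [isCut_iff_forall_isCycle_even_crossings]
  refine ⟨fun hS v c hc hcH => ?_, fun hS v c hc => ?_⟩
  · simpa [crossings] using hS v (c.transfer H hcH) (hc.transfer hcH)
  · simpa [crossings] using hS v (c.mapLe hHG) (hc.mapLe hHG) (by
      simpa using fun e he => c.edges_subset_edgeSet he)

theorem IsCut.symmDiff (hS : IsCut G S) (hT : IsCut G T) : IsCut G (S ∆ T) := by
  obtain ⟨U, hU⟩ := hS
  obtain ⟨W, hW⟩ := hT
  refine ⟨U ∆ W, fun i j h => ?_⟩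
  simp only [mem_symmDiff, hU i j h, hW i j h]
  tauto

theorem IsCut.isBipartite (hS : IsCut G S) (hGS : G.edgeSet ⊆ S) : G.IsBipartite := by
  obtain ⟨U, hU⟩ := hS
  have hcolor : ∀ {i j}, G.Adj i j → (i ∈ U) ≠ (j ∈ U) := fun {i j} h hij =>
    iff_not_self (((hU i j h).1 (hGS h)).symm.trans (iff_of_eq hij)).symm
  exact (Coloring.mk (· ∈ U) hcolor).colorable.mono (by simp)

end Cuts

section Coefficients

variable {V : Type*} {G : SimpleGraph V} {a : G.edgeSet → ℝ} {i j : V}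

/-- The set of positive edges, encoded as unordered pairs so that it can be tested for being a cut
of a subgraph of `G`. -/
def posEdges (a : G.edgeSet → ℝ) : Set (Sym2 V) :=
  (↑) '' {e | 0 < a e}

/-- The subgraph of `G` formed by the edges with a nonzero coefficient; `Q = conv B` depends only on
the signs along its edges. -/
def supportGraph (a : G.edgeSet → ℝ) : SimpleGraph V :=
  fromEdgeSet ((↑) '' Function.support a)

theorem mk_mem_posEdges (h : G.Adj i j) : s(i, j) ∈ posEdges a ↔ 0 < a ⟨s(i, j), h⟩ :=
  Subtype.val_injective.mem_set_image (a := ⟨s(i, j), h⟩)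

theorem supportGraph_adj (h : G.Adj i j) : (supportGraph a).Adj i j ↔ a ⟨s(i, j), h⟩ ≠ 0 := by
  rw [supportGraph, fromEdgeSet_adj, and_iff_left h.ne]
  exact Subtype.val_injective.mem_set_image (a := ⟨s(i, j), h⟩)

theorem supportGraph_le : supportGraph a ≤ G := by
  rintro i j ⟨⟨e, -, he⟩, -⟩
  exact (he ▸ e.2 : s(i, j) ∈ G.edgeSet)

theorem coe_mem_edgeSet_supportGraph (e : G.edgeSet) :
    (e : Sym2 V) ∈ (supportGraph a).edgeSet ↔ a e ≠ 0 := by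
  obtain ⟨⟨i, j⟩, h⟩ := e
  exact supportGraph_adj h

theorem supportGraph_neg : supportGraph (-a) = supportGraph a := by
  rw [supportGraph, supportGraph, Function.support_neg]

theorem supportGraph_eq_self (ha : ∀ e, a e ≠ 0) : supportGraph a = G :=
  supportGraph_le.antisymm fun _ _ h => (supportGraph_adj h).2 (ha _)

theorem edgeSet_supportGraph_subset_symmDiff :
    (supportGraph a).edgeSet ⊆ posEdges a ∆ posEdges (-a) := by
  rintro ⟨i, j⟩ hij
  have h : G.Adj i j := supportGraph_le hij
  change s(i, j) ∈ _
  rw [mem_symmDiff, mk_mem_posEdges h, mk_mem_posEdges h, Pi.neg_apply, neg_pos]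
  rcases ((supportGraph_adj h).1 hij).lt_or_gt with hneg | hpos
  · exact .inr ⟨hneg, hneg.not_gt⟩
  · exact .inl ⟨hpos, hpos.not_gt⟩

end Coefficients

variable {n : ℕ} {G : SimpleGraph (Fin n)} {a : G.edgeSet → ℝ}

theorem numPos_eq_crossings {u v : Fin n} {p : G.Walk u v} (hp : p.IsTrail) :
    numPos a p = crossings (posEdges a) p := by
  rw [← ncard_edges_inter_eq_crossings hp, numPos,
    ← ncard_image_of_injective _ Subtype.val_injective]
  congr 1
  ext e
  simp only [posEdges, mem_image, mem_inter_iff, mem_ofPred_eq]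
  grind

theorem numNeg_eq_numPos_neg {u v : Fin n} (p : G.Walk u v) : numNeg a p = numPos (-a) p := by
  simp only [numNeg, numPos, Pi.neg_apply, neg_pos]

theorem isCut_posEdges_iff :
    IsCut (supportGraph a) (posEdges a) ↔ ∀ (v : Fin n) (c : G.Walk v v), c.IsCycle →
      (∀ e : G.edgeSet, (e : Sym2 (Fin n)) ∈ c.edges → a e ≠ 0) → Even (numPos a c) := by
  rw [isCut_iff_forall_isCycle_of_le supportGraph_le]
  refine forall₃_congr fun v c hc => ?_
  rw [numPos_eq_crossings hc.isTrail]
  refine imp_congr_left ⟨fun h e he => (coe_mem_edgeSet_supportGraph e).1 (h e he),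
    fun h e he => (coe_mem_edgeSet_supportGraph ⟨e, c.edges_subset_edgeSet he⟩).2 (h _ he)⟩

section Products

variable {x : Fin n → ℝ}

theorem pairProd_mem_Icc (hx : x ∈ Icc (0 : Fin n → ℝ) 1) (e : Sym2 (Fin n)) :
    pairProd x e ∈ Icc (0 : ℝ) 1 := by
  induction e with
  | _ i j => exact ⟨mul_nonneg (hx.1 i) (hx.1 j), mul_le_one₀ (hx.2 i) (hx.1 j) (hx.2 j)⟩

theorem pairProd_mem_polytopeP (hx : x ∈ Icc (0 : Fin n → ℝ) 1) :
    (x, fun e : G.edgeSet => pairProd x e) ∈ polytopeP G := by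
  refine ⟨hx, ⟨fun e => (pairProd_mem_Icc hx e).1, fun e => (pairProd_mem_Icc hx e).2⟩,
    fun i j _ => ⟨mul_le_of_le_one_right (hx.1 i) (hx.2 j),
      mul_le_of_le_one_left (hx.1 j) (hx.2 i), ?_⟩⟩
  have hprod : 0 ≤ (1 - x i) * (1 - x j) :=
    mul_nonneg (sub_nonneg.2 (hx.2 i)) (sub_nonneg.2 (hx.2 j))
  change x i + x j - 1 ≤ x i * x j
  linarith

theorem convex_polytopeP : Convex ℝ (polytopeP G) := by
  rintro ⟨x, y⟩ ⟨hx, hy, h⟩ ⟨x', y'⟩ ⟨hx', hy', h'⟩ α β hα hβ hαβ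
  refine ⟨convex_Icc _ _ hx hx' hα hβ hαβ, convex_Icc _ _ hy hy' hα hβ hαβ, fun i j hij => ?_⟩
  obtain ⟨hi, hj, hsum⟩ := h i j hij
  obtain ⟨hi', hj', hsum'⟩ := h' i j hij
  simp only [Prod.fst_add, Prod.snd_add, Prod.smul_fst, Prod.smul_snd, Pi.add_apply,
    Pi.smul_apply, smul_eq_mul] at *
  refine ⟨by gcongr, by gcongr, ?_⟩
  calc α * x i + β * x' i + (α * x j + β * x' j) - 1
      = α * (x i + x j - 1) + β * (x' i + x' j - 1) := by linear_combination hαβ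
    _ ≤ _ := by gcongr

end Products

section Relaxation

variable [DecidableRel G.Adj] {x : Fin n → ℝ} {z : ℝ}

theorem convex_relaxQ : Convex ℝ (relaxQ G a) := by
  rintro ⟨x, z⟩ ⟨y, hy, hz⟩ ⟨x', z'⟩ ⟨y', hy', hz'⟩ α β hα hβ hαβ
  refine ⟨α • y + β • y', convex_polytopeP hy hy' hα hβ hαβ, ?_⟩
  simp only [Prod.snd_add, Prod.smul_snd, smul_eq_mul, Pi.add_apply, Pi.smul_apply, mul_add,
    mul_left_comm, Finset.sum_add_distrib, ← Finset.mul_sum] at *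
  rw [hz, hz']

theorem graphSet_subset_relaxQ : graphSet G a ⊆ relaxQ G a :=
  fun p hp => ⟨fun e => pairProd p.1 e, pairProd_mem_polytopeP hp.1, hp.2⟩

theorem convexHull_graphSet_subset_relaxQ : convexHull ℝ (graphSet G a) ⊆ relaxQ G a :=
  convexHull_min graphSet_subset_relaxQ convex_relaxQ

theorem mem_relaxQ_neg : (x, -z) ∈ relaxQ G (-a) ↔ (x, z) ∈ relaxQ G a := by
  simp [relaxQ]

theorem mem_convexHull_graphSet_neg :
    (x, -z) ∈ convexHull ℝ (graphSet G (-a)) ↔ (x, z) ∈ convexHull ℝ (graphSet G a) := by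
  let reflect := (LinearEquiv.refl ℝ (Fin n → ℝ)).prodCongr (LinearEquiv.neg ℝ (M := ℝ))
  have hgraph : graphSet G (-a) = reflect '' graphSet G a := by
    rw [LinearEquiv.image_eq_preimage_symm]
    ext p
    simp [reflect, graphSet, bilin, neg_eq_iff_eq_neg]
  have himage := reflect.toLinearMap.image_convexHull (graphSet G a)
  rw [hgraph]
  exact (himage ▸ reflect.injective.mem_set_image (a := (x, z)) :)

theorem relaxQ_neg_eq_convexHull (h : relaxQ G a = convexHull ℝ (graphSet G a)) :
    relaxQ G (-a) = convexHull ℝ (graphSet G (-a)) := by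
  ext ⟨x, z⟩
  rw [← neg_neg z, mem_relaxQ_neg, mem_convexHull_graphSet_neg, h]

end Relaxation

section Rounding

variable {ι : Type*} {U : Set ι} {x : ι → ℝ} {i j : ι}

open Classical in
/-- The thresholds in `(0, 1]` at which coordinate `i` of `x` is rounded up: an interval of length
`x i`, anchored at `0` for `i ∈ U` and at `1` otherwise. -/
noncomputable def roundUpSet (U : Set ι) (x : ι → ℝ) (i : ι) : Set ℝ :=
  if i ∈ U then Ioc 0 (x i) else Ioc (1 - x i) 1

/-- The `0/1` vector obtained from `x` by threshold rounding. For a uniform threshold `t` it has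
expectation `x`; the choice of `U` determines how its coordinates are correlated. -/
noncomputable def rounding (U : Set ι) (x : ι → ℝ) (t : ℝ) (i : ι) : ℝ :=
  (roundUpSet U x i).indicator 1 t

theorem roundUpSet_of_mem (hi : i ∈ U) : roundUpSet U x i = Ioc 0 (x i) := if_pos hi

theorem roundUpSet_of_notMem (hi : i ∉ U) : roundUpSet U x i = Ioc (1 - x i) 1 := if_neg hi

theorem measurableSet_roundUpSet : MeasurableSet (roundUpSet U x i) := by
  unfold roundUpSet
  split_ifs <;> exact measurableSet_Ioc

theorem roundUpSet_subset (hx : x i ≤ 1) : roundUpSet U x i ⊆ Ioc 0 1 := by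
  unfold roundUpSet
  split_ifs
  · exact Ioc_subset_Ioc_right hx
  · exact Ioc_subset_Ioc_left (sub_nonneg.2 hx)

theorem volume_real_roundUpSet (hx : 0 ≤ x i) : volume.real (roundUpSet U x i) = x i := by
  unfold roundUpSet
  split_ifs <;> simp [hx]

theorem volume_real_roundUpSet_inter_of_iff (hx : x ∈ Icc (0 : ι → ℝ) 1) (hU : i ∈ U ↔ j ∈ U) :
    volume.real (roundUpSet U x i ∩ roundUpSet U x j) = min (x i) (x j) := by
  have hmin : 0 ≤ min (x i) (x j) := le_min (hx.1 i) (hx.1 j)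
  by_cases hi : i ∈ U
  · rw [roundUpSet_of_mem hi, roundUpSet_of_mem (hU.1 hi), Ioc_inter_Ioc, max_self,
      Real.volume_real_Ioc, sub_zero, max_eq_left hmin]
  · rw [roundUpSet_of_notMem hi, roundUpSet_of_notMem (mt hU.2 hi), Ioc_inter_Ioc, min_self,
      max_sub_sub_left, Real.volume_real_Ioc, sub_sub_cancel, max_eq_left hmin]

theorem volume_real_roundUpSet_inter_of_mem_of_notMem (hx : x ∈ Icc (0 : ι → ℝ) 1) (hi : i ∈ U)
    (hj : j ∉ U) :
    volume.real (roundUpSet U x i ∩ roundUpSet U x j) = max (x i + x j - 1) 0 := by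
  have hi' : x i ≤ 1 := hx.2 i
  have hj' : 0 ≤ 1 - x j := sub_nonneg.2 (hx.2 j)
  rw [roundUpSet_of_mem hi, roundUpSet_of_notMem hj, Ioc_inter_Ioc, max_eq_right hj',
    min_eq_left hi', Real.volume_real_Ioc, ← sub_add, sub_add_eq_add_sub]

theorem volume_real_roundUpSet_inter_of_iff_not (hx : x ∈ Icc (0 : ι → ℝ) 1)
    (hU : i ∈ U ↔ j ∉ U) :
    volume.real (roundUpSet U x i ∩ roundUpSet U x j) = max (x i + x j - 1) 0 := by
  by_cases hi : i ∈ U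
  · exact volume_real_roundUpSet_inter_of_mem_of_notMem hx hi (hU.1 hi)
  · rw [inter_comm, add_comm (x i)]
    exact volume_real_roundUpSet_inter_of_mem_of_notMem hx (not_not.1 (mt hU.2 hi)) hi

theorem rounding_eq_zero_or_one (t : ℝ) (i : ι) : rounding U x t i = 0 ∨ rounding U x t i = 1 :=
  indicator_eq_zero_or_self _ _ t

theorem measurable_rounding : Measurable (rounding U x) :=
  measurable_pi_lambda _ fun _ => measurable_one.indicator measurableSet_roundUpSet

theorem setIntegral_Ioc_indicator_one {A : Set ℝ} (hA : MeasurableSet A) (hA' : A ⊆ Ioc 0 1) :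
    ∫ t in Ioc (0 : ℝ) 1, A.indicator (1 : ℝ → ℝ) t = volume.real A := by
  rw [integral_indicator_one hA, measureReal_restrict_apply hA, inter_eq_left.2 hA']

theorem setIntegral_rounding (hx : x ∈ Icc (0 : ι → ℝ) 1) (i : ι) :
    ∫ t in Ioc (0 : ℝ) 1, rounding U x t i = x i :=
  (setIntegral_Ioc_indicator_one measurableSet_roundUpSet (roundUpSet_subset (hx.2 i))).trans
    (volume_real_roundUpSet (hx.1 i))

theorem setIntegral_rounding_mul_rounding (hx : x ∈ Icc (0 : ι → ℝ) 1) (i j : ι) :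
    ∫ t in Ioc (0 : ℝ) 1, rounding U x t i * rounding U x t j =
      volume.real (roundUpSet U x i ∩ roundUpSet U x j) := by
  have hmul : (fun t => rounding U x t i * rounding U x t j) =
      (roundUpSet U x i ∩ roundUpSet U x j).indicator 1 := by
    rw [inter_indicator_one]
    rfl
  rw [hmul]
  exact setIntegral_Ioc_indicator_one (measurableSet_roundUpSet.inter measurableSet_roundUpSet)
    (inter_subset_left.trans (roundUpSet_subset (hx.2 i)))

end Rounding

section Exactness

variable [DecidableRel G.Adj] {x : Fin n → ℝ} {z : ℝ}

theorem measurable_pairProd (e : Sym2 (Fin n)) : Measurable fun x : Fin n → ℝ => pairProd x e := by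
  induction e with
  | _ i j => exact (measurable_pi_apply i).mul (measurable_pi_apply j)

theorem integral_mem_convexHull_range {Ω E : Type*} [MeasurableSpace Ω] [NormedAddCommGroup E]
    [NormedSpace ℝ E] [CompleteSpace E] {μ : Measure Ω} [IsProbabilityMeasure μ] {f : Ω → E}
    (hf : Integrable f μ) (hfinite : (range f).Finite) :
    ∫ ω, f ω ∂μ ∈ convexHull ℝ (range f) :=
  (convex_convexHull ℝ _).integral_mem (hfinite.isClosed_convexHull ℝ)
    (.of_forall fun ω => subset_convexHull ℝ _ (mem_range_self ω)) hf

theorem integral_mem_convexHull_graphSet {Ω : Type*} [MeasurableSpace Ω] (μ : Measure Ω)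
    [IsProbabilityMeasure μ] {r : Ω → Fin n → ℝ} (hr : Measurable r)
    (hr01 : ∀ ω i, r ω i = 0 ∨ r ω i = 1) :
    (fun i => ∫ ω, r ω i ∂μ, ∑ e : G.edgeSet, a e * ∫ ω, pairProd (r ω) e ∂μ) ∈
      convexHull ℝ (graphSet G a) := by
  have hcube (ω) : r ω ∈ Icc (0 : Fin n → ℝ) 1 :=
    ⟨fun i => by rcases hr01 ω i with h | h <;> simp [h],
      fun i => by rcases hr01 ω i with h | h <;> simp [h]⟩
  have hint (i) : Integrable (fun ω => r ω i) μ :=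
    .of_mem_Icc 0 1 (measurable_pi_iff.1 hr i).aemeasurable
      (.of_forall fun ω => ⟨(hcube ω).1 i, (hcube ω).2 i⟩)
  have hintProd (e : Sym2 (Fin n)) : Integrable (fun ω => pairProd (r ω) e) μ :=
    .of_mem_Icc 0 1 ((measurable_pairProd e).comp hr).aemeasurable
      (.of_forall fun ω => pairProd_mem_Icc (hcube ω) e)
  have hintBilin : Integrable (fun ω => bilin G a (r ω)) μ :=
    integrable_finsetSum _ fun e _ => (hintProd e).const_mul _
  have hfinite : (range fun ω => (r ω, bilin G a (r ω))).Finite := by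
    have hpi : {y : Fin n → ℝ | ∀ i, y i ∈ ({0, 1} : Set ℝ)}.Finite :=
      .pi' fun _ => toFinite _
    refine (hpi.image fun y => (y, bilin G a y)).subset ?_
    rintro _ ⟨ω, rfl⟩
    exact ⟨r ω, hr01 ω, rfl⟩
  have hsub : (range fun ω => (r ω, bilin G a (r ω))) ⊆ graphSet G a := by
    rintro _ ⟨ω, rfl⟩
    exact ⟨hcube ω, rfl⟩
  have hcoord : ∫ ω, r ω ∂μ = fun i => ∫ ω, r ω i ∂μ := funext fun i => eval_integral hint i
  have hbilin : ∫ ω, bilin G a (r ω) ∂μ = ∑ e : G.edgeSet, a e * ∫ ω, pairProd (r ω) e ∂μ := by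
    simp only [bilin]
    rw [integral_finsetSum _ fun (e : G.edgeSet) _ => (hintProd e).const_mul (a e)]
    simp only [integral_const_mul]
  have hmem := convexHull_mono hsub
    (integral_mem_convexHull_range ((Integrable.of_eval hint).prodMk hintBilin) hfinite)
  rwa [integral_pair (Integrable.of_eval hint) hintBilin, hcoord, hbilin] at hmem

theorem mem_convexHull_graphSet_of_rounding (U : Set (Fin n)) (hx : x ∈ Icc (0 : Fin n → ℝ) 1) :
    (x, ∑ e : G.edgeSet, a e * ∫ t in Ioc (0 : ℝ) 1, pairProd (rounding U x t) e) ∈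
      convexHull ℝ (graphSet G a) := by
  have : IsProbabilityMeasure (volume.restrict (Ioc (0 : ℝ) 1)) := ⟨by simp⟩
  simpa only [setIntegral_rounding hx] using
    integral_mem_convexHull_graphSet (a := a) (volume.restrict (Ioc 0 1))
      (measurable_rounding (U := U) (x := x)) rounding_eq_zero_or_one

theorem exists_le_mem_convexHull_of_isCut (h : IsCut (supportGraph a) (posEdges a))
    (hxz : (x, z) ∈ relaxQ G a) : ∃ z' ≤ z, (x, z') ∈ convexHull ℝ (graphSet G a) := by
  obtain ⟨U, hU⟩ := h
  obtain ⟨y, ⟨hx, hy, hxy⟩, rfl⟩ := hxz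
  refine ⟨_, Finset.sum_le_sum ?_, mem_convexHull_graphSet_of_rounding U hx⟩
  rintro ⟨⟨i, j⟩, hij⟩ -
  obtain ⟨hyi, hyj, hyij⟩ := hxy i j hij
  change a ⟨s(i, j), hij⟩ * ∫ t in Ioc 0 1, rounding U x t i * rounding U x t j ≤
    a ⟨s(i, j), hij⟩ * y ⟨s(i, j), hij⟩
  rw [setIntegral_rounding_mul_rounding hx]
  have hcut (h0 : a ⟨s(i, j), hij⟩ ≠ 0) : 0 < a ⟨s(i, j), hij⟩ ↔ (i ∈ U ↔ j ∉ U) :=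
    (mk_mem_posEdges hij).symm.trans (hU i j ((supportGraph_adj hij).2 h0))
  rcases lt_trichotomy (a ⟨s(i, j), hij⟩) 0 with hneg | hzero | hpos
  · have hside : i ∈ U ↔ j ∈ U := by
      have := mt (hcut hneg.ne).2 hneg.not_gt
      tauto
    rw [volume_real_roundUpSet_inter_of_iff hx hside]
    exact mul_le_mul_of_nonpos_left (le_min hyi hyj) hneg.le
  · rw [hzero, zero_mul, zero_mul]
  · rw [volume_real_roundUpSet_inter_of_iff_not hx ((hcut hpos.ne').1 hpos)]
    exact mul_le_mul_of_nonneg_left (max_le hyij (hy.1 _)) hpos.le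

theorem relaxQ_eq_convexHull_of_isCut (hpos : IsCut (supportGraph a) (posEdges a))
    (hneg : IsCut (supportGraph a) (posEdges (-a))) :
    relaxQ G a = convexHull ℝ (graphSet G a) := by
  refine Subset.antisymm (fun ⟨x, z⟩ hp => ?_) convexHull_graphSet_subset_relaxQ
  obtain ⟨z₁, hz₁, h₁⟩ := exists_le_mem_convexHull_of_isCut hpos hp
  obtain ⟨z₂, hz₂, h₂⟩ := exists_le_mem_convexHull_of_isCut (supportGraph_neg.symm ▸ hneg)
    (mem_relaxQ_neg.2 hp)
  rw [← neg_neg z₂, mem_convexHull_graphSet_neg] at h₂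
  have hfibre : Convex ℝ (Prod.mk x ⁻¹' convexHull ℝ (graphSet G a)) := by
    intro w hw w' hw' α β hα hβ hαβ
    have hcomb := convex_convexHull ℝ (graphSet G a) hw hw' hα hβ hαβ
    rwa [Prod.smul_mk, Prod.smul_mk, Prod.mk_add_mk, ← add_smul, hαβ, one_smul] at hcomb
  exact hfibre.ordConnected.out h₁ h₂ ⟨hz₁, le_neg.1 hz₂⟩

end Exactness

section EdgeBound

variable {x : Fin n → ℝ} {c : ℝ} {i j : Fin n}

/-- The sum `x i + x j` attached to the unordered pair `s(i, j)`, the linear part of `edgeBound`. -/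
def pairSum (x : Fin n → ℝ) (e : Sym2 (Fin n)) : ℝ :=
  Sym2.lift ⟨fun i j => x i + x j, fun _ _ => add_comm _ _⟩ e

/-- An affine lower bound for the term `c * x i * x j` on the cube: `x i * x j` is replaced by the
average of the McCormick lower bounds `0` and `x i + x j - 1` if `0 < c`, and by the average of the
upper bounds `x i` and `x j` if `c < 0`. -/
noncomputable def edgeBound (c : ℝ) (x : Fin n → ℝ) (e : Sym2 (Fin n)) : ℝ :=
  (c * pairSum x e - c⁺) / 2

theorem mul_pairProd_sub_edgeBound (c : ℝ) (x : Fin n → ℝ) (i j : Fin n) :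
    c * pairProd x s(i, j) - edgeBound c x s(i, j) =
      (c⁺ * (x i * x j + (1 - x i) * (1 - x j)) +
        c⁻ * (x i * (1 - x j) + (1 - x i) * x j)) / 2 := by
  change c * (x i * x j) - (c * (x i + x j) - c⁺) / 2 = _
  linear_combination (x i * x j - (x i + x j) / 2) * (posPart_sub_negPart c).symm

theorem edgeBound_le (c : ℝ) (hx : x ∈ Icc (0 : Fin n → ℝ) 1) (e : Sym2 (Fin n)) :
    edgeBound c x e ≤ c * pairProd x e := by
  induction e with
  | _ i j =>
    have hi := hx.1 i
    have hj := hx.1 j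
    have hi' := sub_nonneg.2 (hx.2 i)
    have hj' := sub_nonneg.2 (hx.2 j)
    rw [← sub_nonneg, mul_pairProd_sub_edgeBound]
    simp only [Pi.zero_apply, Pi.one_apply] at hi hj hi' hj'
    positivity

theorem pos_iff_of_edgeBound_eq (hc : c ≠ 0) (hx : x ∈ Icc (0 : Fin n → ℝ) 1)
    (h : edgeBound c x s(i, j) = c * pairProd x s(i, j)) :
    0 < c ↔ (x i = 1 ↔ x j ≠ 1) := by
  have hi : 0 ≤ x i := hx.1 i
  have hj : 0 ≤ x j := hx.1 j
  have hi' : 0 ≤ 1 - x i := sub_nonneg.2 (hx.2 i)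
  have hj' : 0 ≤ 1 - x j := sub_nonneg.2 (hx.2 j)
  have hgap := mul_pairProd_sub_edgeBound c x i j
  rw [h, sub_self] at hgap
  rcases hc.lt_or_gt with hneg | hpos
  · rw [posPart_eq_zero.2 hneg.le, negPart_eq_neg.2 hneg.le] at hgap
    have hsum : x i * (1 - x j) + (1 - x i) * x j = 0 :=
      (mul_eq_zero.1 (by linear_combination 2 * hgap)).resolve_left hc
    obtain ⟨hi0, hj0⟩ := (add_eq_zero_iff_of_nonneg (by positivity) (by positivity)).1 hsum
    have hij : x i = x j := by linear_combination hi0 - hj0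
    simp [hneg.not_gt, hij]
  · rw [posPart_eq_self.2 hpos.le, negPart_eq_zero.2 hpos.le] at hgap
    have hsum : x i * x j + (1 - x i) * (1 - x j) = 0 :=
      (mul_eq_zero.1 (by linear_combination -2 * hgap)).resolve_left hc
    obtain ⟨h0, h1⟩ := (add_eq_zero_iff_of_nonneg (by positivity) (by positivity)).1 hsum
    have hij : x i + x j = 1 := by linear_combination h0 - h1
    simp only [hpos, true_iff]
    grind

theorem edgeBound_combo (c : ℝ) (x y : Fin n → ℝ) {α β : ℝ} (h : α + β = 1) (e : Sym2 (Fin n)) :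
    edgeBound c (α • x + β • y) e = α * edgeBound c x e + β * edgeBound c y e := by
  induction e with
  | _ i j =>
    change (c * (α * x i + β * y i + (α * x j + β * y j)) - c⁺) / 2 =
      α * ((c * (x i + x j) - c⁺) / 2) + β * ((c * (y i + y j) - c⁺) / 2)
    linear_combination c⁺ / 2 * h

variable [DecidableRel G.Adj]

theorem center_mem_relaxQ :
    (fun _ => 1 / 2, ∑ e : G.edgeSet, edgeBound (a e) (fun _ : Fin n => 1 / 2) e) ∈
      relaxQ G a := by
  classical
  let y (e : G.edgeSet) : ℝ := if 0 < a e then 0 else 1 / 2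
  have hy0 (e) : 0 ≤ y e := by simp only [y]; split_ifs <;> norm_num
  have hy1 (e) : y e ≤ 1 / 2 := by simp only [y]; split_ifs <;> norm_num
  have hcube : (fun _ => 1 / 2 : Fin n → ℝ) ∈ Icc (0 : Fin n → ℝ) 1 :=
    ⟨fun _ => by norm_num, fun _ => by norm_num⟩
  refine ⟨y, ⟨hcube, ⟨hy0, fun e => (hy1 e).trans (by norm_num)⟩,
    fun i j h => ⟨hy1 _, hy1 _, ?_⟩⟩, ?_⟩
  · norm_num [hy0]
  · change ∑ e : G.edgeSet, edgeBound (a e) (fun _ : Fin n => 1 / 2) e =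
      ∑ e : G.edgeSet, a e * y e
    refine Finset.sum_congr rfl ?_
    rintro ⟨⟨i, j⟩, h⟩ -
    change (a _ * (1 / 2 + 1 / 2) - (a _)⁺) / 2 = a _ * y ⟨s(i, j), h⟩
    simp only [y]
    split_ifs with hpos
    · rw [posPart_eq_self.2 hpos.le]; ring
    · rw [posPart_eq_zero.2 (not_lt.1 hpos)]; ring

theorem exists_forall_edgeBound_eq
    (h : (fun _ => 1 / 2, ∑ e : G.edgeSet, edgeBound (a e) (fun _ : Fin n => 1 / 2) e) ∈
      convexHull ℝ (graphSet G a)) :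
    ∃ x ∈ Icc (0 : Fin n → ℝ) 1, ∀ e : G.edgeSet, edgeBound (a e) x e = a e * pairProd x e := by
  by_contra! hne
  have hconv : ConvexOn ℝ univ fun x : Fin n → ℝ => ∑ e : G.edgeSet, edgeBound (a e) x e :=
    ⟨convex_univ, fun x _ y _ α β _ _ hαβ => le_of_eq (by
      simp only [edgeBound_combo _ x y hαβ, Finset.sum_add_distrib, Finset.mul_sum, smul_eq_mul])⟩
  have habove : graphSet G a ⊆
      {p | p.1 ∈ univ ∧ ∑ e : G.edgeSet, edgeBound (a e) p.1 e < p.2} := by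
    rintro ⟨x, z⟩ ⟨hx, hz⟩
    obtain ⟨e, he⟩ := hne x hx
    exact ⟨mem_univ x, hz ▸ Finset.sum_lt_sum (fun e _ => edgeBound_le _ hx e)
      ⟨e, Finset.mem_univ e, (edgeBound_le _ hx e).lt_of_ne he⟩⟩
  exact lt_irrefl _ (convexHull_min habove hconv.convex_strict_epigraph h).2

theorem isCut_posEdges_of_relaxQ_eq (h : relaxQ G a = convexHull ℝ (graphSet G a)) :
    IsCut (supportGraph a) (posEdges a) := by
  obtain ⟨x, hx, hxe⟩ := exists_forall_edgeBound_eq (h ▸ center_mem_relaxQ (a := a))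
  refine ⟨{i | x i = 1}, fun i j hij => ?_⟩
  have hG : G.Adj i j := supportGraph_le hij
  rw [mk_mem_posEdges hG]
  exact pos_iff_of_edgeBound_eq ((supportGraph_adj hG).1 hij) hx (hxe ⟨s(i, j), hG⟩)

theorem relaxQ_eq_convexHull_iff_isCut :
    relaxQ G a = convexHull ℝ (graphSet G a) ↔
      IsCut (supportGraph a) (posEdges a) ∧ IsCut (supportGraph a) (posEdges (-a)) :=
  ⟨fun h => ⟨isCut_posEdges_of_relaxQ_eq h,
      supportGraph_neg (a := a) ▸ isCut_posEdges_of_relaxQ_eq (relaxQ_neg_eq_convexHull h)⟩,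
    fun h => relaxQ_eq_convexHull_of_isCut h.1 h.2⟩

theorem relaxQ_eq_convexHull_iff_forall_isCycle :
    relaxQ G a = convexHull ℝ (graphSet G a) ↔
      ∀ (v : Fin n) (c : G.Walk v v), c.IsCycle →
        (∀ e : G.edgeSet, (e : Sym2 (Fin n)) ∈ c.edges → a e ≠ 0) →
          Even (numPos a c) ∧ Even (numNeg a c) := by
  have hneg := isCut_posEdges_iff (a := -a)
  simp only [supportGraph_neg, Pi.neg_apply, neg_ne_zero, ← numNeg_eq_numPos_neg] at hneg
  rw [relaxQ_eq_convexHull_iff_isCut, isCut_posEdges_iff, hneg]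
  simp only [imp_and, forall_and]

theorem isBipartite_supportGraph (h : relaxQ G a = convexHull ℝ (graphSet G a)) :
    (supportGraph a).IsBipartite :=
  have ⟨hpos, hneg⟩ := relaxQ_eq_convexHull_iff_isCut.1 h
  (hpos.symmDiff hneg).isBipartite edgeSet_supportGraph_subset_symmDiff

theorem exists_relaxQ_ne_convexHull (hG : ¬ G.IsAcyclic) :
    ∃ a : G.edgeSet → ℝ, (∀ e, a e ≠ 0) ∧ relaxQ G a ≠ convexHull ℝ (graphSet G a) := by
  classical
  obtain ⟨v, c, hc⟩ : ∃ (v : Fin n) (c : G.Walk v v), c.IsCycle := by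
    simpa [IsAcyclic] using hG
  obtain ⟨e, he⟩ := List.exists_mem_of_ne_nil c.edges (mt Walk.edges_eq_nil.1 hc.not_nil)
  let e₀ : G.edgeSet := ⟨e, c.edges_subset_edgeSet he⟩
  let a (e' : G.edgeSet) : ℝ := if e' = e₀ then 1 else -1
  have ha (e') : a e' ≠ 0 := by simp only [a]; split_ifs <;> norm_num
  have hpos (e') : 0 < a e' ↔ e' = e₀ := by simp only [a]; split_ifs with h <;> simp [h]
  have hnum : numPos a c = 1 := by
    rw [numPos, ncard_eq_one]
    refine ⟨e₀, ?_⟩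
    ext e'
    simp only [hpos, mem_ofPred_eq, mem_singleton_iff, and_iff_right_iff_imp]
    rintro rfl
    exact he
  refine ⟨a, ha, fun h => ?_⟩
  have heven := (relaxQ_eq_convexHull_iff_forall_isCycle.1 h v c hc fun e _ => ha e).1
  exact Nat.not_even_one (hnum ▸ heven)

end EdgeBound

end Bilin

theorem theorem4_general (n : ℕ) (G : SimpleGraph (Fin n)) [DecidableRel G.Adj] :
    (∀ a : G.edgeSet → ℝ,
      Bilin.relaxQ G a = convexHull ℝ (Bilin.graphSet G a) ↔
        ∀ (v : Fin n) (c : G.Walk v v), c.IsCycle →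
          (∀ e : G.edgeSet, (e : Sym2 (Fin n)) ∈ c.edges → a e ≠ 0) →
            Even (Bilin.numPos a c) ∧ Even (Bilin.numNeg a c)) ∧
    (∀ a : G.edgeSet → ℝ,
      Bilin.relaxQ G a = convexHull ℝ (Bilin.graphSet G a) →
        (Bilin.supportGraph a).IsBipartite) ∧
    (G.IsAcyclic → ∀ a : G.edgeSet → ℝ,
      Bilin.relaxQ G a = convexHull ℝ (Bilin.graphSet G a)) ∧
    (¬ G.IsAcyclic → ∃ a : G.edgeSet → ℝ, (∀ e, a e ≠ 0) ∧
      Bilin.relaxQ G a ≠ convexHull ℝ (Bilin.graphSet G a)) :=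
  ⟨fun _ => Bilin.relaxQ_eq_convexHull_iff_forall_isCycle,
    fun _ => Bilin.isBipartite_supportGraph,
    fun hG _ => Bilin.relaxQ_eq_convexHull_iff_forall_isCycle.2 fun _ c hc => absurd hc (hG c),
    Bilin.exists_relaxQ_ne_convexHull⟩

theorem theorem4 (n : ℕ) (G : SimpleGraph (Fin n)) [DecidableRel G.Adj] :
    (∀ a : G.edgeSet → ℝ, (∀ e, a e ≠ 0) →
      (Bilin.relaxQ G a = convexHull ℝ (Bilin.graphSet G a) ↔
        ∀ (v : Fin n) (c : G.Walk v v), c.IsCycle →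
          Even (Bilin.numPos a c) ∧ Even (Bilin.numNeg a c))) ∧
    (∀ a : G.edgeSet → ℝ, (∀ e, a e ≠ 0) →
      Bilin.relaxQ G a = convexHull ℝ (Bilin.graphSet G a) → G.IsBipartite) ∧
    (G.IsAcyclic → ∀ a : G.edgeSet → ℝ,
      Bilin.relaxQ G a = convexHull ℝ (Bilin.graphSet G a)) ∧
    (¬ G.IsAcyclic → ∃ a : G.edgeSet → ℝ, (∀ e, a e ≠ 0) ∧
      Bilin.relaxQ G a ≠ convexHull ℝ (Bilin.graphSet G a)) := by
  obtain ⟨hcycle, hbipartite, hforest⟩ := theorem4_general n G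
  exact ⟨fun a ha => by simpa [ha] using hcycle a,
    fun a ha h => Bilin.supportGraph_eq_self ha ▸ hbipartite a h, hforest⟩
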